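/- Let $\mathcal D,\mathcal T$ be monoidal categories and let $\mathbf t:\mathcal D\to\mathcal T$ be a strict monoidal functor (a monoidal refinement system; tensor products are written $\bullet$, and composition $c;d$ means "first $c$, then $d$"). An object $P$ of $\mathcal D$ refines $A\in\mathcal T$, written $P\sqsubset A$, if $\mathbf t(P)=A$; for $P\sqsubset A$, $c:A\to B$, $Q\sqsubset B$, a derivation of $(P,c,Q)$ is a morphism $\alpha:P\to Q$ with $\mathbf t(\alpha)=c$. A pushforward of $P\sqsubset A$ along $c:A\to B$ is a refinement $c_*P\sqsubset B$ with a derivation of $(P,c,c_*P)$ through which, for every $d:B\to C$ and $Q\sqsubset C$, each derivation of $(P,c;d,Q)$ factors uniquely by a derivation of $(c_*P,d,Q)$. For $B\in\mathcal T$ let $\mathbf t^+B$ be the category of pairs $(P\sqsubset A,\ c:A\to B)$, a morphism $(P_1,c_1)\to(P_2,c_2)$ being a morphism $\alpha:P_1\to P_2$ with $c_1=\mathbf t(\alpha);c_2$, and let $\mathbf t^-B=(\mathbf t^{\mathrm{op}})^+B$; the objects of $\mathbf t^-B$ are pairs $(d:B\to C,\ R\sqsubset C)$, and a morphism $(d_1,R_1)\to(d_2,R_2)$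 is a morphism $\gamma:R_2\to R_1$ with $d_1=d_2;\mathbf t(\gamma)$. The positive representation of $Q\sqsubset B$ is the presheaf $\mathbf t^+Q$ on $\mathbf t^+B$ sending $(P,c)$ to the set of derivations of $(P,c,Q)$, acting by precomposition. For presheaves $\phi$ on $\mathbf t^+B$ and $\psi$ on $\mathbf t^-B$ define the duals, as presheaves on $\mathbf t^-B$ and $\mathbf t^+B$ respectively, by the ends $$\phi^{\circ}(d,R)=\int_{(P,c)\in\mathbf t^+B}\mathrm{Hom}\bigl(\phi(P,c),\ \mathrm{Der}(P,c;d,R)\bigr),\qquad {}^{\circ}\psi(P,c)=\int_{(d,R)\in\mathbf t^-B}\mathrm{Hom}\bigl(\psi(d,R),\ \mathrm{Der}(P,c;d,R)\bigr),$$ where $\mathrm{Der}(P,e,R)$ is the set of derivations of $(P,e,R)$, acted on by composition on both sides. Let $W$ be a monoid in $\mathcal T$ with multiplication $p:W\bullet W\to W$, and let $P,Q\sqsubset W$ be such that the pushforward $P\otimes_W Q:=p_*(P\bullet Q)$ exists. Let $\mathbf t^+P\otimes_{\mathbf t^+W}\mathbf t^+Q$ be the Day tensor product, i.e. the left Kan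 extension of the presheaf $\bigl((P_1,c_1),(P_2,c_2)\bigr)\mapsto \mathbf t^+P(P_1,c_1)\times\mathbf t^+Q(P_2,c_2)$ along the functor $\mathbf t^+W\times\mathbf t^+W\to\mathbf t^+W$ sending $\bigl((P_1,c_1),(P_2,c_2)\bigr)$ to $\bigl(P_1\bullet P_2,\ (c_1\bullet c_2);p\bigr)$. Then there is a natural isomorphism of presheaves on $\mathbf t^+W$ $$\mathbf t^+(P\otimes_W Q)\;\cong\;{}^{\circ}\bigl((\mathbf t^+P\otimes_{\mathbf t^+W}\mathbf t^+Q)^{\circ}\bigr).$$ -/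

import Mathlib

open CategoryTheory MonoidalCategory Opposite

universe w w' v₁ v₂ v₃ u₁ u₂ u₃

namespace RefinementSystem

noncomputable section

/-! ### Presheaves over varying base categories

A presheaf over `C` is a functor `Cᵒᵖ ⥤ Type w`. Universe levels are kept general throughout, so
that no smallness assumption has to be made; (co)ends are formed in a large enough universe. -/

section Presheaves

variable {A : Type u₁} [Category.{v₁} A] {B : Type u₂} [Category.{v₂} B]
  {C : Type u₃} [Category.{v₃} C]

/-- The pullback `F* ψ = (a ↦ ψ (F a))` of a presheaf along a functor. -/
def pull (F : A ⥤ B) (ψ : Bᵒᵖ ⥤ Type w) : Aᵒᵖ ⥤ Type w := F.op ⋙ ψ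

/-- The relation generating the identifications in the coend `∃ a, B(b, F a) × φ(a)`. -/
inductive PushRel (F : A ⥤ B) (φ : Aᵒᵖ ⥤ Type w) (b : B) :
    (Σ a : A, (b ⟶ F.obj a) × φ.obj (op a)) → (Σ a : A, (b ⟶ F.obj a) × φ.obj (op a)) → Prop
  | glue {a a' : A} (f : a ⟶ a') (g : b ⟶ F.obj a) (x : φ.obj (op a')) :
      PushRel F φ b ⟨a, g, φ.map f.op x⟩ ⟨a', g ≫ F.map f, x⟩

/-- The pushforward `F_* φ = (b ↦ ∃ a, B(b, F a) × φ(a))` of a presheaf along a functor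
(a coend, acting by precomposition in `b`). -/
def push (F : A ⥤ B) (φ : Aᵒᵖ ⥤ Type w) : Bᵒᵖ ⥤ Type (max u₁ v₂ w) where
  obj b := Quot (PushRel F φ b.unop)
  map {b b'} h := TypeCat.ofHom
    (Quot.map (fun s => ⟨s.1, h.unop ≫ s.2.1, s.2.2⟩) (by
      rintro _ _ ⟨f, g, x⟩
      have := PushRel.glue (F := F) (φ := φ) f (h.unop ≫ g) x
      simpa using this))
  map_id b := by
    ext ⟨s⟩
    simp [Quot.map]
  map_comp f g := by
    ext ⟨s⟩
    simp [Quot.map]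

/-- The external tensor product `(a, b) ↦ φ(a) × ψ(b)` over the product category. -/
def extTensor (φ : Aᵒᵖ ⥤ Type w) (ψ : Bᵒᵖ ⥤ Type w') : (A × B)ᵒᵖ ⥤ Type (max w w') where
  obj x := φ.obj (op x.unop.1) × ψ.obj (op x.unop.2)
  map f := TypeCat.ofHom (fun s => (φ.map f.unop.1.op s.1, ψ.map f.unop.2.op s.2))
  map_id x := by
    ext s
    · simp
    · simp
  map_comp f g := by
    ext s
    · simp
    · simp

/-- The residual `F ↦ ∀ a, φ(a) → ω(F a)`, a presheaf over the functor category `A ⥤ C`. The end is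
the type of families natural in `a`. As the product of categories is symmetric, the left residual
`φ \ ω` and the right residual `ω / φ` are both given by this formula. -/
def residual (φ : Aᵒᵖ ⥤ Type w) (ω : Cᵒᵖ ⥤ Type w') : (A ⥤ C)ᵒᵖ ⥤ Type (max u₁ w w') where
  obj F := {θ : ∀ a : A, φ.obj (op a) → ω.obj (op (F.unop.obj a)) //
    ∀ ⦃a a' : A⦄ (f : a ⟶ a') (x : φ.obj (op a')),
      θ a (φ.map f.op x) = ω.map (F.unop.map f).op (θ a' x)}
  map {F G} τ := TypeCat.ofHom (fun θ =>
    ⟨fun a x => ω.map (τ.unop.app a).op (θ.1 a x), by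
      intro a a' f x
      simp only [θ.2 f x, ← Functor.map_comp_apply, ← op_comp, τ.unop.naturality f]⟩)
  map_id F := by
    ext θ a x
    simp
  map_comp σ τ := by
    ext θ a x
    simp

/-- The left currying `B ⥤ (A ⥤ C)` of a functor `p : A × B ⥤ C`. -/
def curryL (p : A × B ⥤ C) : B ⥤ A ⥤ C := Functor.curry.obj (CategoryTheory.Prod.swap B A ⋙ p)

/-- The right currying `A ⥤ (B ⥤ C)` of a functor `p : A × B ⥤ C`. -/
def curryR (p : A × B ⥤ C) : A ⥤ B ⥤ C := Functor.curry.obj p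

/-- Vertical isomorphism of presheaves over the same category, i.e. mutually inverse morphisms
lying over the identity functor: natural isomorphism, after lifting both presheaves to a
common universe. -/
def VIso (φ : Aᵒᵖ ⥤ Type w) (ψ : Aᵒᵖ ⥤ Type w') : Prop :=
  Nonempty (φ ⋙ uliftFunctor.{w', w} ≅ ψ ⋙ uliftFunctor.{w, w'})

end Presheaves

/-! ### Refinement systems

A refinement system is a functor `t : D ⥤ T`; the refinements of `A : T` are the elements of
`t.Fiber A`, and a derivation of the judgment `(P, c, Q)` is a morphism `α : P ⟶ Q` with
`t.IsHomLift c α`. -/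

section Basic

variable {D : Type u₁} [Category.{v₁} D] {T : Type u₂} [Category.{v₂} T] (t : D ⥤ T)

/-- A pushforward of a refinement `P` of `A` along `c : A ⟶ B`: a refinement of `B` with a
derivation of `(P, c, obj)` through which every derivation of `(P, c ≫ d, Q)` factors uniquely as a
derivation of `(obj, d, Q)`. -/
structure Pushforward {A B : T} (c : A ⟶ B) (P : t.Fiber A) where
  obj : t.Fiber B
  hom : P.1 ⟶ obj.1
  universal : t.IsStronglyCocartesian c hom

/-- The relative slice `t⁺B`: objects are pairs `(P, c : t P ⟶ B)`, morphisms
`(P₁, c₁) ⟶ (P₂, c₂)` are `α : P₁ ⟶ P₂` with `t α ≫ c₂ = c₁`. -/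
abbrev PosCat (B : T) := CostructuredArrow t B

/-- The functor `t⁺A ⥤ t⁺B` sending `(P, d)` to `(P, d ≫ c)`. -/
abbrev posMap {A B : T} (c : A ⟶ B) : PosCat t A ⥤ PosCat t B := CostructuredArrow.map c

/-- The positive representation of a refinement `Q` of `B`: the presheaf over `t⁺B` sending
`(P, c)` to the set of derivations of `(P, c, Q)`, acting by precomposition. -/
def pos {B : T} (Q : t.Fiber B) : (PosCat t B)ᵒᵖ ⥤ Type v₁ where
  obj x := {α : x.unop.left ⟶ Q.1 // t.IsHomLift x.unop.hom α}
  map {x y} f := TypeCat.ofHom (fun α => ⟨f.unop.left ≫ α.1, by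
    have := α.2
    rw [← CostructuredArrow.w f.unop]
    infer_instance⟩)
  map_id x := by
    ext α
    simp
  map_comp f g := by
    ext α
    simp

/-- The category `t⁻A`: the relative slice of the opposite refinement system. Its objects amount to
pairs `(c : A ⟶ t Q, Q)`, and it is the opposite of the relative coslice. -/
abbrev NegCat (A : T) := PosCat t.op (op A)

/-- Typing judgments `(P, c, Q)` with `c : t P ⟶ t Q`. -/
structure Judgment where
  src : D
  tgt : D
  term : t.obj src ⟶ t.obj tgt

variable {t} in
/-- A morphism `(P₁, c₁, Q₁) ⟶ (P₂, c₂, Q₂)` is a pair `β : P₁ ⟶ P₂`, `γ : Q₂ ⟶ Q₁` with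
`c₁ = t β ≫ c₂ ≫ t γ`. -/
@[ext]
structure Judgment.Hom (J K : Judgment t) where
  fst : J.src ⟶ K.src
  snd : K.tgt ⟶ J.tgt
  w : J.term = t.map fst ≫ K.term ≫ t.map snd

/-- The category of judgments. -/
instance : Category (Judgment t) where
  Hom := Judgment.Hom
  id J := ⟨𝟙 _, 𝟙 _, by simp⟩
  comp f g := ⟨f.fst ≫ g.fst, g.snd ≫ f.snd, by rw [f.w, g.w]; simp⟩
  id_comp f := by apply Judgment.Hom.ext <;> simp
  comp_id f := by apply Judgment.Hom.ext <;> simp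
  assoc f g h := by apply Judgment.Hom.ext <;> simp

/-- The presheaf of derivations over the category of judgments. -/
def der : (Judgment t)ᵒᵖ ⥤ Type v₁ where
  obj J := {α : J.unop.src ⟶ J.unop.tgt // t.map α = J.unop.term}
  map {J K} f := TypeCat.ofHom (fun α => ⟨f.unop.fst ≫ α.1 ≫ f.unop.snd, by
    simp [α.2, f.unop.w]⟩)
  map_id J := by
    ext α
    change 𝟙 _ ≫ α.1 ≫ 𝟙 _ = α.1
    simp
  map_comp {J K L} f g := by
    ext α
    change (g.unop.fst ≫ f.unop.fst) ≫ α.1 ≫ (f.unop.snd ≫ g.unop.snd) =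
      g.unop.fst ≫ (f.unop.fst ≫ α.1 ≫ f.unop.snd) ≫ g.unop.snd
    simp

/-- The bracket functor `((P, c), (d, R)) ↦ (P, c ≫ d, R)`. -/
def bracket (B : T) : PosCat t B × NegCat t B ⥤ Judgment t where
  obj x := ⟨x.1.left, x.2.left.unop, x.1.hom ≫ x.2.hom.unop⟩
  map {x y} f := ⟨f.1.left, f.2.left.unop, by
    have h₁ : t.map f.1.left ≫ y.1.hom = x.1.hom := CostructuredArrow.w f.1
    have h₂ : y.2.hom.unop ≫ t.map f.2.left.unop = x.2.hom.unop :=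
      congrArg Quiver.Hom.unop (CostructuredArrow.w f.2)
    rw [← h₁, ← h₂]
    simp⟩
  map_id x := rfl
  map_comp f g := rfl

/-- The dual of a presheaf over `t⁺B`: the pullback, along the left currying of the bracket, of
the left residual of the presheaf of derivations by `φ`. -/
def dualL {B : T} (φ : (PosCat t B)ᵒᵖ ⥤ Type w) : (NegCat t B)ᵒᵖ ⥤ Type (max u₁ v₁ v₂ w) :=
  pull (curryL (bracket t B)) (residual φ (der t))

/-- The dual of a presheaf over `t⁻B`: the pullback, along the right currying of the bracket, of
the right residual of the presheaf of derivations by `ψ`. -/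
def dualR {B : T} (ψ : (NegCat t B)ᵒᵖ ⥤ Type w) : (PosCat t B)ᵒᵖ ⥤ Type (max u₁ v₁ v₂ w) :=
  pull (curryR (bracket t B)) (residual ψ (der t))

end Basic

/-! ### Monoidal refinement systems -/

section Monoidal

open Functor.LaxMonoidal Functor.OplaxMonoidal

variable {D : Type u₁} [Category.{v₁} D] {T : Type u₂} [Category.{v₂} T]
  [MonoidalCategory D] [MonoidalCategory T]

/-- A monoidal refinement system: `t` is a strict monoidal functor, i.e. a monoidal functor whose
structure maps are identities. -/
class StrictMonoidal (t : D ⥤ T) extends t.Monoidal where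
  obj_tensor : ∀ P Q : D, t.obj P ⊗ t.obj Q = t.obj (P ⊗ Q)
  obj_unit : 𝟙_ T = t.obj (𝟙_ D)
  μ_eq : ∀ P Q : D, μ P Q = eqToHom (obj_tensor P Q)
  ε_eq : ε = eqToHom obj_unit

variable (t : D ⥤ T) [StrictMonoidal t]

/-- The tensor product of a refinement of `A` and a refinement of `B`, a refinement of `A ⊗ B`. -/
def tensorRef {A B : T} (P : t.Fiber A) (Q : t.Fiber B) : t.Fiber (A ⊗ B) :=
  ⟨P.1 ⊗ Q.1, by rw [← StrictMonoidal.obj_tensor, P.2, Q.2]⟩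

/-- A fiberwise tensor product `P ⊗_W Q` of two refinements of a monoid `W`: a pushforward of
`P ⊗ Q` along the multiplication `W ⊗ W ⟶ W`. -/
abbrev FiberTensor (W : T) [MonObj W] (P Q : t.Fiber W) :=
  Pushforward t (MonObj.mul (X := W)) (tensorRef t P Q)

/-- The functor `t⁺A × t⁺B ⥤ t⁺(A ⊗ B)` sending `((P₁, c₁), (P₂, c₂))` to `(P₁ ⊗ P₂, c₁ ⊗ c₂)`;
here `δ` is the identity of `t (P₁ ⊗ P₂) = t P₁ ⊗ t P₂`. -/
def str (A B : T) : PosCat t A × PosCat t B ⥤ PosCat t (A ⊗ B) where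
  obj x := CostructuredArrow.mk (δ t x.1.left x.2.left ≫ (x.1.hom ⊗ₘ x.2.hom))
  map {x y} f := CostructuredArrow.homMk (f.1.left ⊗ₘ f.2.left) (by
    have h₁ : t.map f.1.left ≫ y.1.hom = x.1.hom := CostructuredArrow.w f.1
    have h₂ : t.map f.2.left ≫ y.2.hom = x.2.hom := CostructuredArrow.w f.2
    rw [← h₁, ← h₂, ← MonoidalCategory.tensorHom_comp_tensorHom]
    exact (δ_natural_assoc t f.1.left f.2.left _).symm)
  map_id x := by
    ext
    simp
  map_comp f g := by
    ext
    simp [MonoidalCategory.tensorHom_comp_tensorHom]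

/-- The Day tensor product of presheaves over `t⁺W` for a monoid `W`: the pushforward of the
external tensor product along the tensor product functor `t⁺W × t⁺W ⥤ t⁺(W ⊗ W) ⥤ t⁺W`. -/
def dayTensor (W : T) [MonObj W] (φ : (PosCat t W)ᵒᵖ ⥤ Type w) (ψ : (PosCat t W)ᵒᵖ ⥤ Type w') :
    (PosCat t W)ᵒᵖ ⥤ Type (max u₁ v₁ v₂ w w') :=
  push (str t W W ⋙ posMap t (MonObj.mul (X := W))) (extTensor φ ψ)

end Monoidal

end

end RefinementSystem

/-!
Everything is a computation with representing objects. A refinement `Q` of `B` is an object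
`(Q, 𝟙)` of `t⁺B`, which represents `t⁺Q`, and an object `(𝟙, Q)` of `t⁻B`. Both the external tensor
product and the pushforward along a functor preserve representability, so the convolution of `t⁺P`
and `t⁺Q` along `c` is represented by `(P ⊗ Q, c)`. By the Yoneda lemma, the dual of a presheaf
represented by `(P, c)` is `(d, R) ↦ Der(P, c ≫ d, R)`, and the universal property of `c_*P` says
exactly that `(𝟙, c_*P)` represents it. By the Yoneda lemma again, the second dual is
`(X, e) ↦ Der(X, e, c_*P)`, that is, `t⁺(c_*P)`.
-/

namespace RefinementSystem

noncomputable section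

section Presheaves

variable {A : Type u₁} [Category.{v₁} A] {B : Type u₂} [Category.{v₂} B]
  {C : Type u₃} [Category.{v₃} C]

lemma VIso.of_representableBy {φ : Aᵒᵖ ⥤ Type w} {ψ : Aᵒᵖ ⥤ Type w'} {a : A}
    (hφ : φ.RepresentableBy a) (hψ : ψ.RepresentableBy a) : VIso φ ψ :=
  ⟨NatIso.ofComponents
    (fun b => (Equiv.ulift.trans
      ((hφ.homEquiv.symm.trans hψ.homEquiv).trans Equiv.ulift.symm)).toIso) (by
      intro b b' f
      ext ⟨x⟩
      apply ULift.down_injective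
      change hψ.homEquiv (hφ.homEquiv.symm (φ.map f.unop.op x)) =
        ψ.map f.unop.op (hψ.homEquiv (hφ.homEquiv.symm x))
      rw [← hφ.comp_homEquiv_symm, hψ.homEquiv_comp])⟩

def extTensorRepresentableBy {φ : Aᵒᵖ ⥤ Type w} {ψ : Bᵒᵖ ⥤ Type w'} {a : A} {b : B}
    (hφ : φ.RepresentableBy a) (hψ : ψ.RepresentableBy b) :
    (extTensor φ ψ).RepresentableBy (a, b) where
  homEquiv := Equiv.prodCongr hφ.homEquiv hψ.homEquiv
  homEquiv_comp f g := Prod.ext (hφ.homEquiv_comp f.1 g.1) (hψ.homEquiv_comp f.2 g.2)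

def pushRepresentableBy (F : A ⥤ B) {φ : Aᵒᵖ ⥤ Type w} {a : A} (h : φ.RepresentableBy a) :
    (push F φ).RepresentableBy (F.obj a) where
  homEquiv {b} :=
    { toFun := fun g => Quot.mk _ ⟨a, g, h.homEquiv (𝟙 a)⟩
      invFun := Quot.lift (fun s => s.2.1 ≫ F.map (h.homEquiv.symm s.2.2)) (by
        rintro _ _ ⟨f, g, x⟩
        simp [← h.comp_homEquiv_symm])
      left_inv := fun g => by simp
      right_inv := by
        rintro ⟨a', g, x⟩
        have glued := Quot.sound
          (PushRel.glue (F := F) (φ := φ) (h.homEquiv.symm x) g (h.homEquiv (𝟙 a)))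
        rw [← h.homEquiv_eq, Equiv.apply_symm_apply] at glued
        exact glued.symm }
  homEquiv_comp _ _ := rfl

/-- The Yoneda lemma: a natural family `∀ x, φ(x) → ω(F x)` is determined by its value at the
universal element of `φ`. -/
def residualEquiv {φ : Aᵒᵖ ⥤ Type w} {a : A} (h : φ.RepresentableBy a) (ω : Cᵒᵖ ⥤ Type w')
    (F : A ⥤ C) : (residual φ ω).obj (op F) ≃ ω.obj (op (F.obj a)) where
  toFun θ := θ.1 a (h.homEquiv (𝟙 a))
  invFun y := ⟨fun _ x => ω.map (F.map (h.homEquiv.symm x)).op y, by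
    intro b b' f x
    simp only [← h.comp_homEquiv_symm, F.map_comp, op_comp, Functor.map_comp_apply]⟩
  left_inv θ := Subtype.ext (funext₂ fun b x => by
    have naturality := θ.2 (h.homEquiv.symm x) (h.homEquiv (𝟙 a))
    rw [← h.homEquiv_eq, Equiv.apply_symm_apply] at naturality
    exact naturality.symm)
  right_inv y := by simp

lemma residualEquiv_symm_naturality {φ : Aᵒᵖ ⥤ Type w} {a : A} (h : φ.RepresentableBy a)
    (ω : Cᵒᵖ ⥤ Type w') {F G : A ⥤ C} (τ : F ⟶ G) (y : ω.obj (op (G.obj a))) :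
    (residualEquiv h ω F).symm (ω.map (τ.app a).op y) =
      (residual φ ω).map τ.op ((residualEquiv h ω G).symm y) := by
  rw [Equiv.symm_apply_eq]
  exact congrArg (ω.map (τ.app a).op) ((residualEquiv h ω G).apply_symm_apply y).symm

def pullResidualRepresentableBy {φ : Aᵒᵖ ⥤ Type w} {a : A} (h : φ.RepresentableBy a)
    {ω : Cᵒᵖ ⥤ Type w'} (G : B ⥤ A ⥤ C) {b : B}
    (k : (pull (G.flip.obj a) ω).RepresentableBy b) :
    (pull G (residual φ ω)).RepresentableBy b where
  homEquiv {b'} := k.homEquiv.trans (residualEquiv h ω (G.obj b')).symm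
  homEquiv_comp f g := (congrArg _ (k.homEquiv_comp f g)).trans
    (residualEquiv_symm_naturality h ω (G.map f) _)

end Presheaves

section Basic

variable {D : Type u₁} [Category.{v₁} D] {T : Type u₂} [Category.{v₂} T] (t : D ⥤ T)

lemma isHomLift_iff_map_eq {A B : T} {X Y : D} (hX : t.obj X = A) (hY : t.obj Y = B)
    (c : A ⟶ B) (α : X ⟶ Y) :
    t.IsHomLift c α ↔ t.map α = eqToHom hX ≫ c ≫ eqToHom hY.symm :=
  ⟨fun _ => IsHomLift.fac' t c α, IsHomLift.of_fac' t c α hX hY⟩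

/-- A refinement `Q` of `B` as the object `(Q, 𝟙)` of `t⁺B`. As `t Q = B` is only a propositional
equality, the identity is an `eqToHom`. -/
def posObj {B : T} (Q : t.Fiber B) : PosCat t B := CostructuredArrow.mk (Y := Q.1) (eqToHom Q.2)

/-- A refinement `Q` of `B` as the object `(𝟙, Q)` of `t⁻B`, the identity being an `eqToHom` as in
`posObj`. -/
def negObj {B : T} (Q : t.Fiber B) : NegCat t B :=
  CostructuredArrow.mk (S := t.op) (Y := op Q.1) (eqToHom Q.2.symm).op

def homPosObjEquiv {B : T} (Q : t.Fiber B) (X : PosCat t B) :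
    (X ⟶ posObj t Q) ≃ {α : X.left ⟶ Q.1 // t.IsHomLift X.hom α} where
  toFun f := ⟨f.left, (isHomLift_iff_map_eq t rfl Q.2 _ _).2 (by
    simpa [posObj, comp_eqToHom_iff] using CostructuredArrow.w f)⟩
  invFun α := CostructuredArrow.homMk α.1 (by
    simpa [posObj, comp_eqToHom_iff] using (isHomLift_iff_map_eq t rfl Q.2 _ _).1 α.2)
  left_inv _ := rfl
  right_inv _ := rfl

def homNegObjEquiv {B : T} (Q : t.Fiber B) (N : NegCat t B) :
    (N ⟶ negObj t Q) ≃ {γ : Q.1 ⟶ N.left.unop // t.IsHomLift N.hom.unop γ} where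
  toFun f := ⟨f.left.unop, (isHomLift_iff_map_eq t Q.2 rfl _ _).2 (by
    simpa [negObj, eqToHom_comp_iff] using congrArg Quiver.Hom.unop (CostructuredArrow.w f))⟩
  invFun γ := CostructuredArrow.homMk γ.1.op (Quiver.Hom.unop_inj (by
    simpa [negObj, eqToHom_comp_iff] using (isHomLift_iff_map_eq t Q.2 rfl _ _).1 γ.2))
  left_inv _ := rfl
  right_inv _ := rfl

def posRepresentableBy {B : T} (Q : t.Fiber B) : (pos t Q).RepresentableBy (posObj t Q) where
  homEquiv {X} := homPosObjEquiv t Q X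
  homEquiv_comp _ _ := rfl

variable {t}

def Pushforward.derivationEquiv {A B C : T} {c : A ⟶ B} {P : t.Fiber A} (R : Pushforward t c P)
    (d : B ⟶ C) (S : D) :
    {γ : R.obj.1 ⟶ S // t.IsHomLift d γ} ≃ {α : P.1 ⟶ S // t.IsHomLift (c ≫ d) α} :=
  have := R.universal
  { toFun γ :=
      have := γ.2
      ⟨R.hom ≫ γ.1, inferInstance⟩
    invFun α :=
      have := α.2
      ⟨Functor.IsStronglyCocartesian.map t c R.hom (g := d) rfl α.1, inferInstance⟩
    left_inv γ :=
      have := γ.2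
      Subtype.ext (Functor.IsStronglyCocartesian.map_uniq t c R.hom rfl _ γ.1 rfl).symm
    right_inv α :=
      have := α.2
      Subtype.ext (Functor.IsStronglyCocartesian.fac t c R.hom rfl α.1) }

/-- The universal property of a pushforward `c_*P`: the presheaf `(d, S) ↦ Der(P, c ≫ d, S)` is
represented by `(𝟙, c_*P)`. -/
def Pushforward.derRepresentableByNegObj {A B : T} {c : A ⟶ B} {P : t.Fiber A}
    (R : Pushforward t c P) :
    (pull ((curryL (bracket t B)).flip.obj ((posMap t c).obj (posObj t P)))
      (der t)).RepresentableBy (negObj t R.obj) where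
  homEquiv {N} := ((homNegObjEquiv t R.obj N).trans (R.derivationEquiv N.hom.unop _)).trans
    (Equiv.subtypeEquivRight fun α => by
      simp [isHomLift_iff_map_eq t P.2 rfl, curryL, bracket, posObj])
  homEquiv_comp f g := by
    apply Subtype.ext
    change R.hom ≫ g.left.unop ≫ f.left.unop = 𝟙 P.1 ≫ (R.hom ≫ g.left.unop) ≫ f.left.unop
    rw [Category.id_comp]
    exact (Category.assoc _ _ _).symm

variable (t) in
def derRepresentableByPosObj {B : T} (Q : t.Fiber B) :
    (pull ((curryR (bracket t B)).flip.obj (negObj t Q)) (der t)).RepresentableBy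
      (posObj t Q) where
  homEquiv {X} := (homPosObjEquiv t Q X).trans (Equiv.subtypeEquivRight fun α => by
    change t.IsHomLift X.hom α ↔ t.map α = X.hom ≫ eqToHom Q.2.symm
    rw [isHomLift_iff_map_eq t rfl Q.2, eqToHom_refl, Category.id_comp])
  homEquiv_comp f g := by
    apply Subtype.ext
    change f.left ≫ g.left = f.left ≫ g.left ≫ 𝟙 Q.1
    exact congrArg (f.left ≫ ·) (Category.comp_id g.left).symm

def Pushforward.bidualRepresentableBy {A B : T} {c : A ⟶ B} {P : t.Fiber A}
    (R : Pushforward t c P) {φ : (PosCat t B)ᵒᵖ ⥤ Type w}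
    (h : φ.RepresentableBy ((posMap t c).obj (posObj t P))) :
    (dualR t (dualL t φ)).RepresentableBy (posObj t R.obj) :=
  pullResidualRepresentableBy (pullResidualRepresentableBy h _ R.derRepresentableByNegObj) _
    (derRepresentableByPosObj t R.obj)

end Basic

section Monoidal

open Functor.LaxMonoidal Functor.OplaxMonoidal

variable {D : Type u₁} [Category.{v₁} D] {T : Type u₂} [Category.{v₂} T]
  [MonoidalCategory D] [MonoidalCategory T] (t : D ⥤ T) [StrictMonoidal t]

lemma StrictMonoidal.δ_eq (P Q : D) : δ t P Q = eqToHom (obj_tensor (t := t) P Q).symm := by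
  rw [← cancel_epi (μ t P Q), Functor.Monoidal.μ_δ, StrictMonoidal.μ_eq]
  simp

lemma str_obj_posObj {A B : T} (P : t.Fiber A) (Q : t.Fiber B) :
    (str t A B).obj (posObj t P, posObj t Q) = posObj t (tensorRef t P Q) := by
  obtain ⟨P, rfl⟩ := P
  obtain ⟨Q, rfl⟩ := Q
  simp [str, posObj, tensorRef, StrictMonoidal.δ_eq]

def convolutionRepresentableBy {A B C : T} (c : A ⊗ B ⟶ C) (P : t.Fiber A) (Q : t.Fiber B) :
    (push (str t A B ⋙ posMap t c) (extTensor (pos t P) (pos t Q))).RepresentableBy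
      ((posMap t c).obj (posObj t (tensorRef t P Q))) :=
  str_obj_posObj t P Q ▸ pushRepresentableBy (str t A B ⋙ posMap t c)
    (extTensorRepresentableBy (posRepresentableBy t P) (posRepresentableBy t Q))

end Monoidal

end

end RefinementSystem

open RefinementSystem in
theorem mainTheorem5_general {D : Type u₁} [Category.{v₁} D] {T : Type u₂} [Category.{v₂} T]
    [MonoidalCategory D] [MonoidalCategory T] (t : D ⥤ T) [StrictMonoidal t] {A B C : T}
    (c : A ⊗ B ⟶ C) (P : t.Fiber A) (Q : t.Fiber B) (R : Pushforward t c (tensorRef t P Q)) :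
    VIso (pos t R.obj)
      (dualR t (dualL t (push (str t A B ⋙ posMap t c) (extTensor (pos t P) (pos t Q))))) :=
  VIso.of_representableBy (posRepresentableBy t R.obj)
    (R.bidualRepresentableBy (convolutionRepresentableBy t c P Q))

theorem mainTheorem5 {D : Type u₁} [Category.{v₁} D] {T : Type u₂}
    [Category.{v₂} T] [MonoidalCategory D] [MonoidalCategory T] (t : D ⥤ T)
    [RefinementSystem.StrictMonoidal t] (W : T) [MonObj W] (P Q : t.Fiber W)
    (PQ : RefinementSystem.FiberTensor t W P Q) :
    RefinementSystem.VIso (RefinementSystem.pos t PQ.obj)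
      (RefinementSystem.dualR t (RefinementSystem.dualL t
        (RefinementSystem.dayTensor t W (RefinementSystem.pos t P)
          (RefinementSystem.pos t Q)))) :=
  mainTheorem5_general t (MonObj.mul (X := W)) P Q PQ
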